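/- **Setting.** Let $S\ge 2$, $M\ge 2$, $L\ge 1$ and let $\mathbb F$ be a finite field; entropies are taken in base $|\mathbb F|$. The messages $W_1,\dots,W_M$ are independent and uniformly distributed on $\mathbb F^{L}$, and each of $S$ servers stores all of them. For every wanted index $m\in[1:M]$ the user sends random query matrices $Q_j^{(m)}\in\mathbb F^{d_j\times ML}$, $j\in[1:S]$, with $Q^{(m)}_{1:S}$ independent of the messages, and server $j$ answers linearly, $X_j^{(m)}=Q_j^{(m)}(W_1,\dots,W_M)^{\top}$. The scheme is correct, $H(W_m\mid X^{(m)}_{1:S},Q^{(m)}_{1:S})=0$ for all $m$, and private against each single server: for each $j$ the distribution of $Q_j^{(m)}$ does not depend on $m$. Its rate is $$\mathcal R=\min_{m}\frac{H(W_m)}{\sum_{j=1}^S H(X_j^{(m)}\mid Q_j^{(m)})}.$$ For $\mathcal I\subseteq[1:M]$ write $Q[\mathcal I]$ for the submatrix of $Q$ formed by the columns belonging to the messages in $\mathcal I$, and $\bar m=[1:M]\setminus\{m\}$; $Q_{1:S}^{(m)}$ is the matrix obtained by stacking $Q_1^{(m)},\dots,Q_S^{(m)}$. **Theorem.** The scheme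 attains the capacity, $$\mathcal R=\frac{1-\frac1S}{1-\left(\frac1S\right)^M},$$ if and only if both of the following hold: 1. for all $m\in[1:M]$ and all $i,j\in[1:S]$, $\;H(X_j^{(m)}\mid X_i^{(m)},W_m,Q_{1:S}^{(m)})=0$; 2. for all $m\in[1:M]$ and all $\bar{\mathcal I}\subseteq[1:M]\setminus\{m\}$ the answers $X_1^{(m)},\dots,X_S^{(m)}$ are conditionally independent given $(Q_{1:S}^{(m)},W_{\bar{\mathcal I}})$, that is, for all $j\in[1:S]$ and all $\mathcal T\subseteq[1:S]\setminus\{j\}$, $$H(X_j^{(m)}\mid Q_{1:S}^{(m)},W_{\bar{\mathcal I}},X_{\mathcal T}^{(m)})=H(X_j^{(m)}\mid Q_{1:S}^{(m)},W_{\bar{\mathcal I}}).$$ Moreover, condition 1 is equivalent to its matrix form: for all $m$, every realization of $Q^{(m)}_{1:S}$ (i.e. every value taken with positive probability) satisfies $\operatorname{rank}Q_{1:S}^{(m)}[\bar m]=\operatorname{rank}Q_j^{(m)}[\bar m]$ for all $j\in[1:S]$. Condition 2 is equivalent to its matrix form: for all $m$, every realization of $Q^{(m)}_{1:S}$ satisfies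 $\operatorname{rank}Q_{1:S}^{(m)}[\mathcal I]=\sum_{j=1}^S\operatorname{rank}Q_j^{(m)}[\mathcal I]$ for all $\mathcal I\subseteq[1:M]$ with $m\in\mathcal I$. -/

import Mathlib

open MeasureTheory ProbabilityTheory

noncomputable section

/-- Shannon entropy `H(X)`, in base `b`, of a random variable with finitely many values. -/
def entropy {Ω α : Type*} [MeasurableSpace Ω] [Fintype α] (b : ℝ) (μ : Measure Ω)
    (X : Ω → α) : ℝ :=
  ∑ x, Real.negMulLog (μ.real (X ⁻¹' {x})) / Real.log b

/-- Conditional Shannon entropy `H(X | Y) = ∑ y, Pr{Y = y} H(X | Y = y)`, in base `b`. -/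
def condEntropy {Ω α β : Type*} [MeasurableSpace Ω] [Fintype α] [Fintype β] (b : ℝ)
    (μ : Measure Ω) (X : Ω → α) (Y : Ω → β) : ℝ :=
  ∑ y, μ.real (Y ⁻¹' {y}) * entropy b (μ[|Y ⁻¹' {y}]) X

/-- Row index of the stacked query matrix: the row `⟨j, r⟩` is the `r`-th row sent to server `j`,
so `d j` is the number of symbols in the answer of server `j`. -/
abbrev QueryRow {S : ℕ} (d : Fin S → ℕ) : Type := (j : Fin S) × Fin (d j)

/-- The stacked query matrix `Q_{1:S}`. The column `(k, l)` multiplies the `l`-th symbol of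
message `k`. -/
abbrev QueryMatrix (F : Type*) {S : ℕ} (M L : ℕ) (d : Fin S → ℕ) : Type _ :=
  Matrix (QueryRow d) (Fin M × Fin L) F

/-- Matrices carry the product σ-algebra of their entries. -/
instance matrixMeasurableSpace {ρ κ α : Type*} [MeasurableSpace α] :
    MeasurableSpace (Matrix ρ κ α) :=
  inferInstanceAs (MeasurableSpace (ρ → κ → α))

namespace QueryMatrix

variable {F : Type*} {S M L : ℕ} {d : Fin S → ℕ}

/-- The block of rows `Q_j` sent to server `j`. -/
def block (Q : QueryMatrix F M L d) (j : Fin S) : Matrix (Fin (d j)) (Fin M × Fin L) F :=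
  Q.submatrix (fun r => ⟨j, r⟩) id

end QueryMatrix

/-- The submatrix `A[I]` formed by the columns that belong to the messages in `I`. -/
def messageColumns {F ρ : Type*} {M L : ℕ} (A : Matrix ρ (Fin M × Fin L) F)
    (I : Finset (Fin M)) : Matrix ρ (I × Fin L) F :=
  A.submatrix id (fun c => ((c.1 : Fin M), c.2))

/-- The random messages and random queries of a linear scheme with `S` servers and `M` messages
of length `L` over the finite field `F`, on a probability space `(Ω, μ)`. The messages are
independent and uniform on `F ^ L`, and for each wanted index `m` the queries `query m` are a
random matrix independent of the messages. -/
structure LinearScheme (F : Type*) [Field F] [Fintype F] [MeasurableSpace F] {S : ℕ} (M L : ℕ)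
    (d : Fin S → ℕ) {Ω : Type*} [MeasurableSpace Ω] (μ : Measure Ω) where
  msg : Fin M → Ω → (Fin L → F)
  query : Fin M → Ω → QueryMatrix F M L d
  measurable_msg : ∀ k, Measurable (msg k)
  measurable_query : ∀ m, Measurable (query m)
  indep_msg : iIndepFun msg μ
  uniform_msg : ∀ k w, μ.real (msg k ⁻¹' {w}) = 1 / (Fintype.card F : ℝ) ^ L
  indep_query : ∀ m, IndepFun (fun ω k => msg k ω) (query m) μ

namespace LinearScheme

variable {F : Type*} [Field F] [Fintype F] [MeasurableSpace F] {S M L : ℕ} {d : Fin S → ℕ}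
  {Ω : Type*} [MeasurableSpace Ω] {μ : Measure Ω}

/-- The query `Q_j^{(m)}` sent to server `j` when the wanted index is `m`. -/
def serverQuery (P : LinearScheme F M L d μ) (m : Fin M) (j : Fin S) (ω : Ω) :
    Matrix (Fin (d j)) (Fin M × Fin L) F :=
  (P.query m ω).block j

/-- The answer `X_j^{(m)} = Q_j^{(m)} (W_1, …, W_M)ᵀ` of server `j` when the wanted index
is `m`. -/
def answer (P : LinearScheme F M L d μ) (m : Fin M) (j : Fin S) (ω : Ω) : Fin (d j) → F :=
  (P.serverQuery m j ω).mulVec (fun c => P.msg c.1 ω c.2)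

/-- The tuple of answers `X_T^{(m)}` of the servers in `T`. -/
def answers (P : LinearScheme F M L d μ) (m : Fin M) (T : Finset (Fin S)) (ω : Ω) :
    (j : T) → Fin (d j) → F :=
  fun j => P.answer m j ω

/-- The tuple of messages `W_I`. -/
def msgs (P : LinearScheme F M L d μ) (I : Finset (Fin M)) (ω : Ω) : I → Fin L → F :=
  fun k => P.msg k ω

/-- Shannon entropy measured in symbols of `F`. -/
def H (_P : LinearScheme F M L d μ) {α : Type*} [Fintype α] (X : Ω → α) : ℝ :=
  entropy (Fintype.card F) μ X

/-- Conditional Shannon entropy measured in symbols of `F`. -/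
def condH (_P : LinearScheme F M L d μ) {α β : Type*} [Fintype α] [Fintype β]
    (X : Ω → α) (Y : Ω → β) : ℝ :=
  condEntropy (Fintype.card F) μ X Y

/-- Correctness: `H(W_m | X_{1:S}^{(m)}, Q_{1:S}^{(m)}) = 0` for every `m`. -/
def IsCorrect (P : LinearScheme F M L d μ) : Prop :=
  ∀ m, P.condH (P.msg m) (fun ω => (P.answers m Finset.univ ω, P.query m ω)) = 0

/-- Privacy against each single server: the law of the query sent to a server does not depend on
the wanted index. -/
def IsPrivate (P : LinearScheme F M L d μ) : Prop :=
  ∀ (m m' : Fin M) (j : Fin S) (q : Matrix (Fin (d j)) (Fin M × Fin L) F),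
    μ.real (P.serverQuery m j ⁻¹' {q}) = μ.real (P.serverQuery m' j ⁻¹' {q})

/-- The rate `min_m H(W_m) / ∑ j, H(X_j^{(m)} | Q_j^{(m)})`. -/
def rate (P : LinearScheme F M L d μ) : ℝ :=
  ⨅ m : Fin M, P.H (P.msg m) / ∑ j, P.condH (P.answer m j) (P.serverQuery m j)

/-- The matrix `q` is a realization of the queries for the wanted index `m`. -/
def IsRealization (P : LinearScheme F M L d μ) (m : Fin M) (q : QueryMatrix F M L d) : Prop :=
  0 < μ.real (P.query m ⁻¹' {q})

end LinearScheme

/-- The capacity `(1 - 1/S) / (1 - (1/S)^M)` of standard private information retrieval. -/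
def pirCapacity (S M : ℕ) : ℝ := (1 - 1 / (S : ℝ)) / (1 - (1 / (S : ℝ)) ^ M)

end

/-! ### Conditional entropy of linear functions of a uniform vector -/

section Entropy

variable {Ω : Type*} [MeasurableSpace Ω] {μ : Measure Ω}

/-! Given the queries, all answers are linear images of one uniform vector, so every conditional
entropy involved is an expected difference of kernel dimensions (`condEntropy_linear`), that is, of
ranks of column submatrices.

Let `f I` be the expectation of `∑ j, rank Q_j[I]`; by privacy it does not depend on the wanted
index, and the rate is `L / f univ`. For `m ∈ I`, `∑ j, rank Q_j[I] ≥ rank Q[I] = L + rank Q[I \ m]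
≥ L + (1/S) ∑ j, rank Q_j[I \ m]`, where the middle equality is correctness. Hence `f I ≥ L + f (I \
m) / S` (`le_blockRankSum`), and iterating down to `∅` gives `f univ ≥ L (1 + 1/S + ⋯ + 1/S^(M-1))`,
which is the capacity bound.

The capacity is attained iff each of these inequalities is tight for all `I` and `m`
(`eq_univ_iff_of_recursive_bound`), hence at each realization. Tightness of the left one is
condition 2. Tightness of the right one says that all blocks have the row space of the stacked
matrix on `I \ m`; this passes to fewer columns, so `I = univ` suffices, which is condition 1. -/

theorem condEntropy_comp_injective {α β γ : Type*} [Fintype α] [Fintype β] [Fintype γ] (b : ℝ)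
    (X : Ω → α) (Y : Ω → β) {e : β → γ} (he : Function.Injective e) :
    condEntropy b μ X (fun ω => e (Y ω)) = condEntropy b μ X Y := by
  refine (Fintype.sum_of_injective e he _ _ (fun c hc => ?_) (fun y => ?_)).symm
  · have : (fun ω => e (Y ω)) ⁻¹' {c} = ∅ := by
      ext ω
      simp only [Set.mem_preimage, Set.mem_singleton_iff, Set.mem_empty_iff_false, iff_false]
      exact fun h => hc ⟨_, h⟩
    rw [this, measureReal_empty, zero_mul]
  · have : (fun ω => e (Y ω)) ⁻¹' {e y} = Y ⁻¹' {y} := by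
      ext ω
      simp [he.eq_iff]
    rw [this]

/-- If every value of `X` has probability `0` or `b ^ (-r)`, then `H(X) = r`. -/
theorem entropy_eq_of_flat {α : Type*} [Fintype α] {b : ℝ} (hb : 1 < b) {r : ℝ} {X : Ω → α}
    (hsum : ∑ x, μ.real (X ⁻¹' {x}) = 1)
    (hflat : ∀ x, μ.real (X ⁻¹' {x}) = 0 ∨ μ.real (X ⁻¹' {x}) = b ^ (-r)) :
    entropy b μ X = r := by
  have hlog : Real.log b ≠ 0 := (Real.log_pos hb).ne'
  have key : ∀ x, Real.negMulLog (μ.real (X ⁻¹' {x})) / Real.log b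
      = μ.real (X ⁻¹' {x}) * r := by
    intro x
    rcases hflat x with h | h
    · simp [h]
    · rw [h, Real.negMulLog, Real.log_rpow (by linarith)]
      field_simp
  rw [entropy, Finset.sum_congr rfl fun x _ => key x, ← Finset.sum_mul, hsum, one_mul]

theorem sum_measureReal_inter_preimage {α : Type*} [Fintype α] [IsFiniteMeasure μ] {X : Ω → α}
    (hX : ∀ x, MeasurableSet (X ⁻¹' {x})) {s : Set Ω} (hs : MeasurableSet s) :
    ∑ x, μ.real (s ∩ X ⁻¹' {x}) = μ.real s := by
  rw [← measureReal_iUnion_fintype]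
  · congr 1
    ext ω
    simp
  · intro x y hxy
    refine Set.disjoint_left.2 fun ω h1 h2 => hxy ?_
    exact h1.2.symm.trans h2.2
  · exact fun x => hs.inter (hX x)

/-- The expectation of `f ∘ g` under the law of `Q` is that of `f` under the law of `g ∘ Q`. -/
theorem sum_measureReal_mul_comp {α β : Type*} [Fintype α] [Fintype β] [IsFiniteMeasure μ]
    {Q : Ω → α} (hQ : ∀ q, MeasurableSet (Q ⁻¹' {q})) (g : α → β) (f : β → ℝ) :
    ∑ q, μ.real (Q ⁻¹' {q}) * f (g q) = ∑ a, μ.real ((fun ω => g (Q ω)) ⁻¹' {a}) * f a := by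
  classical
  have hg : ∀ a, MeasurableSet ((fun ω => g (Q ω)) ⁻¹' {a}) := by
    intro a
    have : (fun ω => g (Q ω)) ⁻¹' {a} = ⋃ q ∈ {q | g q = a}, Q ⁻¹' {q} := by
      ext ω
      simp
    rw [this]
    exact MeasurableSet.biUnion (Set.to_countable _) fun q _ => hQ q
  have hsum : ∀ a, μ.real ((fun ω => g (Q ω)) ⁻¹' {a}) * f a
      = ∑ q, μ.real ((fun ω => g (Q ω)) ⁻¹' {a} ∩ Q ⁻¹' {q}) * f a := fun a => by
    rw [← Finset.sum_mul, sum_measureReal_inter_preimage hQ (hg a)]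
  rw [Finset.sum_congr rfl fun a _ => hsum a, Finset.sum_comm]
  refine Finset.sum_congr rfl fun q _ => ?_
  rw [Finset.sum_eq_single (g q)]
  · congr 2
    ext ω
    simp only [Set.mem_preimage, Set.mem_singleton_iff, Set.mem_inter_iff]
    exact ⟨fun h => ⟨by rw [h], h⟩, fun h => h.2⟩
  · intro a _ ha
    have : (fun ω => g (Q ω)) ⁻¹' {a} ∩ Q ⁻¹' {q} = ∅ := by
      ext ω
      simp only [Set.mem_preimage, Set.mem_singleton_iff, Set.mem_inter_iff,
        Set.mem_empty_iff_false, iff_false]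
      rintro ⟨h1, h2⟩
      exact ha (by rw [← h1, h2])
    rw [this, measureReal_empty, zero_mul]
  · simp

theorem measureReal_inter_preimage_of_uniform {V : Type*} [Fintype V] [IsFiniteMeasure μ] {W : Ω → V} {A : Set Ω}
    (hA : MeasurableSet A) (hW : ∀ v, MeasurableSet (W ⁻¹' {v}))
    (hunif : ∀ v, μ.real (A ∩ W ⁻¹' {v}) = μ.real A / Fintype.card V) (E : Set V) :
    μ.real (A ∩ W ⁻¹' E) = μ.real A / Fintype.card V * E.ncard := by
  classical
  have h : A ∩ W ⁻¹' E = ⋃ v ∈ E.toFinset, A ∩ W ⁻¹' {v} := by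
    ext ω
    simp
  rw [h, measureReal_biUnion_finset]
  · simp_rw [hunif]
    rw [Finset.sum_const, nsmul_eq_mul, mul_comm, Set.ncard_eq_toFinset_card']
  · intro x _ y _ hxy
    refine Set.disjoint_left.2 fun ω h1 h2 => hxy ?_
    exact h1.2.symm.trans h2.2
  · exact fun v _ => hA.inter (hW v)

variable {F V V₁ V₂ κ : Type*} [Field F] [Fintype F] [AddCommGroup V] [Module F V] [Fintype V]
  [AddCommGroup V₁] [Module F V₁] [AddCommGroup V₂] [Module F V₂]

/-- A nonempty fibre is a translate of the kernel. Equal fibre sizes are what makes the conditional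
laws flat. -/
theorem LinearMap.ncard_fiber (C : V →ₗ[F] V₁) (v₀ : V) :
    {v | C v = C v₀}.ncard = Fintype.card F ^ Module.finrank F (LinearMap.ker C) := by
  have h : {v | C v = C v₀} = (fun v => v₀ + v) '' (LinearMap.ker C : Set V) := by
    ext v
    simp only [Set.mem_ofPred_eq, Set.mem_image, SetLike.mem_coe, LinearMap.mem_ker]
    constructor
    · intro h
      exact ⟨v - v₀, by rw [map_sub, h, sub_self], by abel⟩
    · rintro ⟨w, hw, rfl⟩
      rw [map_add, hw, add_zero]
  rw [h, Set.ncard_image_of_injective _ (add_right_injective v₀), ← Nat.card_coe_set_eq,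
    ← Nat.card_eq_fintype_card (α := F)]
  exact Module.natCard_eq_pow_finrank (K := F) (V := LinearMap.ker C)

/-- If `W` is uniform on `V` and independent of `Q`, then `H(A_Q W | Q, B_Q W)` is the expectation
of `dim ker B_Q - dim (ker A_Q ⊓ ker B_Q)`. -/
theorem condEntropy_linear [Fintype κ] [Fintype V₁] [Fintype V₂] [IsProbabilityMeasure μ] {W : Ω → V} {Q : Ω → κ}
    (hW : ∀ v, MeasurableSet (W ⁻¹' {v})) (hQ : ∀ q, MeasurableSet (Q ⁻¹' {q}))
    (hunif : ∀ q v, μ.real (Q ⁻¹' {q} ∩ W ⁻¹' {v}) = μ.real (Q ⁻¹' {q}) / Fintype.card V)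
    (A : κ → V →ₗ[F] V₁) (B : κ → V →ₗ[F] V₂) :
    condEntropy (Fintype.card F) μ (fun ω => A (Q ω) (W ω)) (fun ω => (Q ω, B (Q ω) (W ω)))
      = ∑ q, μ.real (Q ⁻¹' {q}) * ((Module.finrank F (LinearMap.ker (B q)) : ℝ)
          - Module.finrank F (LinearMap.ker (A q) ⊓ LinearMap.ker (B q) : Submodule F V)) := by
  have hF : (1 : ℝ) < Fintype.card F := by exact_mod_cast Fintype.one_lt_card
  have hF0 : (0 : ℝ) < Fintype.card F := by linarith
  have hWE : ∀ E : Set V, MeasurableSet (W ⁻¹' E) := by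
    intro E
    have : W ⁻¹' E = ⋃ v ∈ E, W ⁻¹' {v} := by
      ext ω
      simp
    rw [this]
    exact MeasurableSet.biUnion (Set.to_countable _) fun v _ => hW v
  have hY : ∀ q c, (fun ω => (Q ω, B (Q ω) (W ω))) ⁻¹' {(q, c)}
      = Q ⁻¹' {q} ∩ W ⁻¹' {v | B q v = c} := by
    intro q c
    ext ω
    simp only [Set.mem_preimage, Set.mem_singleton_iff, Prod.mk.injEq, Set.mem_inter_iff,
      Set.mem_ofPred_eq]
    exact and_congr_right fun h => by rw [h]
  have hXY : ∀ q c x, (Q ⁻¹' {q} ∩ W ⁻¹' {v | B q v = c}) ∩ (fun ω => A (Q ω) (W ω)) ⁻¹' {x}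
      = Q ⁻¹' {q} ∩ W ⁻¹' {v | ((A q).prod (B q)) v = (x, c)} := by
    intro q c x
    ext ω
    simp only [Set.mem_preimage, Set.mem_singleton_iff, Set.mem_inter_iff, Set.mem_ofPred_eq,
      LinearMap.prod_apply, Function.prod, Prod.mk.injEq]
    constructor
    · rintro ⟨⟨h1, h2⟩, h3⟩
      exact ⟨h1, by rw [← h1, h3], h2⟩
    · rintro ⟨h1, h2, h3⟩
      exact ⟨⟨h1, h3⟩, by rw [h1, h2]⟩
  have hX : ∀ x, MeasurableSet ((fun ω => A (Q ω) (W ω)) ⁻¹' {x}) := by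
    intro x
    have : (fun ω => A (Q ω) (W ω)) ⁻¹' {x} = ⋃ q, Q ⁻¹' {q} ∩ W ⁻¹' {v | A q v = x} := by
      ext ω
      simp
    rw [this]
    exact MeasurableSet.iUnion fun q => (hQ q).inter (hWE _)
  rw [condEntropy, Fintype.sum_prod_type]
  refine Finset.sum_congr rfl fun q _ => ?_
  set r : ℝ := (Module.finrank F (LinearMap.ker (B q)) : ℝ)
    - Module.finrank F (LinearMap.ker (A q) ⊓ LinearMap.ker (B q) : Submodule F V) with hr
  have hterm : ∀ c, μ.real ((fun ω => (Q ω, B (Q ω) (W ω))) ⁻¹' {(q, c)})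
      * entropy (Fintype.card F) (μ[|(fun ω => (Q ω, B (Q ω) (W ω))) ⁻¹' {(q, c)}])
        (fun ω => A (Q ω) (W ω))
      = μ.real (Q ⁻¹' {q} ∩ W ⁻¹' {v | B q v = c}) * r := by
    intro c
    rw [hY]
    set Y := Q ⁻¹' {q} ∩ W ⁻¹' {v | B q v = c} with hYdef
    have hYm : MeasurableSet Y := (hQ q).inter (hWE _)
    by_cases h0 : μ.real Y = 0
    · rw [h0, zero_mul, zero_mul]
    have hcond : ∀ s, (μ[|Y]).real s = (μ.real Y)⁻¹ * μ.real (Y ∩ s) :=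
      fun s => by
      rw [measureReal_def, cond_apply hYm, ENNReal.toReal_mul, ENNReal.toReal_inv]
      rfl
    congr 1
    refine entropy_eq_of_flat hF ?_ fun x => ?_
    · simp_rw [hcond]
      rw [← Finset.mul_sum, sum_measureReal_inter_preimage hX hYm, inv_mul_cancel₀ h0]
    · rw [hcond, hXY, hYdef,
        measureReal_inter_preimage_of_uniform (hQ q) hW (hunif q),
        measureReal_inter_preimage_of_uniform (hQ q) hW (hunif q)]
      -- The conditional probability of `x` is the ratio of the fibre sizes of `(A, B)` over `(x,
      -- c)` and of `B` over `c`: zero if the first fibre is empty, `|F| ^ (-r)` otherwise.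
      rcases Set.eq_empty_or_nonempty {v | ((A q).prod (B q)) v = (x, c)} with he | ⟨v₀, hv₀⟩
      · left
        rw [he]
        simp
      right
      have hv1 : A q v₀ = x := congrArg Prod.fst hv₀
      have hv2 : B q v₀ = c := congrArg Prod.snd hv₀
      have e1 := LinearMap.ncard_fiber ((A q).prod (B q)) v₀
      have e2 := LinearMap.ncard_fiber (B q) v₀
      rw [show ((A q).prod (B q)) v₀ = (x, c) from hv₀, LinearMap.ker_prod] at e1
      rw [hv2] at e2
      have hp : μ.real (Q ⁻¹' {q}) / Fintype.card V ≠ 0 := by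
        intro hp
        apply h0
        rw [hYdef, measureReal_inter_preimage_of_uniform (hQ q) hW (hunif q), hp, zero_mul]
      rw [e1, e2, hr, neg_sub, Real.rpow_sub hF0, Real.rpow_natCast, Real.rpow_natCast]
      push_cast
      have : (Fintype.card F : ℝ) ^ Module.finrank F (LinearMap.ker (B q)) ≠ 0 :=
        pow_ne_zero _ hF0.ne'
      rw [mul_inv, mul_mul_mul_comm, inv_mul_cancel₀ hp, one_mul, div_eq_inv_mul]
  rw [Finset.sum_congr rfl fun c _ => hterm c, ← Finset.sum_mul]
  congr 1
  rw [← sum_measureReal_inter_preimage (X := fun ω => B q (W ω)) (fun c => hWE {v | B q v = c})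
    (hQ q)]
  rfl

end Entropy

/-! ### Relative codimension and ranks of submatrices -/

section Codim

variable {F V ι : Type*} [Field F] [AddCommGroup V] [Module F V]

/-- The codimension of `U ⊓ K` in `U`. -/
noncomputable def relCodim (U K : Submodule F V) : ℕ :=
  Module.finrank F U - Module.finrank F (U ⊓ K : Submodule F V)

theorem relCodim_top (U : Submodule F V) : relCodim U ⊤ = 0 := by
  rw [relCodim, inf_top_eq, Nat.sub_self]

variable [FiniteDimensional F V]

theorem relCodim_add_finrank (U K : Submodule F V) :
    relCodim U K + Module.finrank F (U ⊓ K : Submodule F V) = Module.finrank F U :=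
  Nat.sub_add_cancel (Submodule.finrank_mono inf_le_left)

theorem relCodim_anti (U : Submodule F V) {K K' : Submodule F V} (h : K ≤ K') :
    relCodim U K' ≤ relCodim U K :=
  Nat.sub_le_sub_left (Submodule.finrank_mono (inf_le_inf_left U h)) _

/-- The dimension formula inside `U`: the sum of the two traces still lies in `U`. -/
theorem relCodim_inf_le (U K K' : Submodule F V) :
    relCodim U (K ⊓ K') ≤ relCodim U K + relCodim U K' := by
  have h := Submodule.finrank_sup_add_finrank_inf_eq (U ⊓ K) (U ⊓ K')
  have h1 : Module.finrank F ((U ⊓ K) ⊔ (U ⊓ K') : Submodule F V) ≤ Module.finrank F U :=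
    Submodule.finrank_mono (sup_le inf_le_left inf_le_left)
  rw [← inf_inf_distrib_left] at h
  have := relCodim_add_finrank U K
  have := relCodim_add_finrank U K'
  have := relCodim_add_finrank U (K ⊓ K')
  omega

/-- Turns an equality of ranks into an equality of subspaces, which can then be intersected further.
-/
theorem inf_eq_of_relCodim_eq {U K K' : Submodule F V} (h : K' ≤ K)
    (hc : relCodim U K = relCodim U K') : U ⊓ K' = U ⊓ K := by
  refine Submodule.eq_of_le_of_finrank_eq (inf_le_inf_left U h) ?_
  have := relCodim_add_finrank U K
  have := relCodim_add_finrank U K'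
  omega

theorem finrank_map_eq_relCodim {V' : Type*} [AddCommGroup V'] [Module F V'] (U : Submodule F V)
    (A : V →ₗ[F] V') : Module.finrank F (U.map A) = relCodim U (LinearMap.ker A) := by
  have h := LinearMap.finrank_range_add_finrank_ker (A.domRestrict U)
  rw [LinearMap.range_domRestrict, LinearMap.ker_domRestrict] at h
  have h2 : Module.finrank F ((LinearMap.ker A).comap U.subtype)
      = Module.finrank F (U ⊓ LinearMap.ker A : Submodule F V) := by
    rw [← Submodule.map_comap_subtype]
    exact (Submodule.equivMapOfInjective _ U.subtype_injective _).finrank_eq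
  have := relCodim_add_finrank U (LinearMap.ker A)
  omega

theorem relCodim_finset_inf_le_sum (U : Submodule F V) (K : ι → Submodule F V) (T : Finset ι) :
    relCodim U (T.inf K) ≤ ∑ j ∈ T, relCodim U (K j) := by
  classical
  induction T using Finset.induction_on with
  | empty => simp [relCodim_top]
  | insert j T hj ih =>
    rw [Finset.inf_insert, Finset.sum_insert hj]
    exact (relCodim_inf_le _ _ _).trans (by omega)

/-- Additivity of the codimension along a finite family can be tested one member at a time. -/
theorem relCodim_insert_eq_iff [Fintype ι] (U : Submodule F V) (K : ι → Submodule F V) :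
    (∀ j (T : Finset ι), j ∉ T →
      relCodim U (K j ⊓ T.inf K) = relCodim U (K j) + relCodim U (T.inf K)) ↔
    relCodim U (Finset.univ.inf K) = ∑ j, relCodim U (K j) := by
  classical
  constructor
  · intro h
    have key : ∀ T : Finset ι, relCodim U (T.inf K) = ∑ j ∈ T, relCodim U (K j) := by
      intro T
      induction T using Finset.induction_on with
      | empty => simp [relCodim_top]
      | insert j T hj ih => rw [Finset.inf_insert, Finset.sum_insert hj, h j T hj, ih]
    exact key _
  · intro h j T hj
    refine le_antisymm (relCodim_inf_le _ _ _) ?_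
    -- Subadditivity is applied to `{j}`, `T` and the remaining indices; as the total is additive,
    -- none of these inequalities can be strict.
    have e : Finset.univ.inf K = (K j ⊓ T.inf K) ⊓ ((insert j T)ᶜ : Finset ι).inf K := by
      rw [← Finset.inf_insert, ← Finset.inf_union, Finset.union_compl]
    have h1 := relCodim_inf_le U (K j ⊓ T.inf K) (((insert j T)ᶜ : Finset ι).inf K)
    rw [← e, h, ← Finset.sum_add_sum_compl (insert j T), Finset.sum_insert hj] at h1
    have h2 := relCodim_finset_inf_le_sum U K (insert j T)ᶜ
    have h3 := relCodim_finset_inf_le_sum U K T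
    omega

/-- The traces on `U` of a finite family of subspaces coincide iff this holds pairwise. -/
theorem relCodim_pair_eq_iff [Fintype ι] (U : Submodule F V) (K : ι → Submodule F V) :
    (∀ i j, relCodim U (K j ⊓ K i) = relCodim U (K i)) ↔
    ∀ j, relCodim U (Finset.univ.inf K) = relCodim U (K j) := by
  constructor
  · intro h i
    have hle : ∀ j, U ⊓ K i ≤ K j := by
      intro j
      rw [← inf_eq_of_relCodim_eq (inf_le_right : K j ⊓ K i ≤ K i) (h i j).symm]
      exact inf_le_right.trans inf_le_left
    have e : U ⊓ Finset.univ.inf K = U ⊓ K i := by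
      refine le_antisymm (inf_le_inf_left U (Finset.inf_le (Finset.mem_univ i))) ?_
      exact le_inf inf_le_left (Finset.le_inf fun j _ => hle j)
    rw [relCodim, relCodim, e]
  · intro h i j
    refine le_antisymm ?_ (relCodim_anti U inf_le_right)
    rw [← h i]
    exact relCodim_anti U
      (le_inf (Finset.inf_le (Finset.mem_univ j)) (Finset.inf_le (Finset.mem_univ i)))

end Codim

/-! ### Ranks of column submatrices as relative codimensions of kernels. -/

section Columns

variable {F : Type*} [Field F] {M L : ℕ}

/-- The vectors of message symbols that vanish on the messages outside `I`. -/
def supportedOn (F : Type*) [Field F] {M : ℕ} (L : ℕ) (I : Finset (Fin M)) :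
    Submodule F (Fin M × Fin L → F) where
  carrier := {v | ∀ c, c.1 ∉ I → v c = 0}
  add_mem' hv hw c hc := by rw [Pi.add_apply, hv c hc, hw c hc, add_zero]
  zero_mem' _ _ := rfl
  smul_mem' a v hv c hc := by rw [Pi.smul_apply, hv c hc, smul_zero]

theorem mem_supportedOn {I : Finset (Fin M)} {v : Fin M × Fin L → F} :
    v ∈ supportedOn F L I ↔ ∀ c, c.1 ∉ I → v c = 0 := Iff.rfl

theorem supportedOn_univ : supportedOn F L (Finset.univ : Finset (Fin M)) = ⊤ := by
  refine eq_top_iff.2 fun v _ c hc => absurd (Finset.mem_univ _) hc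

theorem supportedOn_mono {I J : Finset (Fin M)} (h : I ⊆ J) :
    supportedOn F L I ≤ supportedOn F L J :=
  fun _ hv c hc => hv c fun hI => hc (h hI)

/-- Extension by zero of the symbols of the messages in `I`. -/
def extendZero (F : Type*) [Field F] {M : ℕ} (L : ℕ) (I : Finset (Fin M)) :
    (I × Fin L → F) →ₗ[F] (Fin M × Fin L → F) where
  toFun x c := if h : c.1 ∈ I then x (⟨c.1, h⟩, c.2) else 0
  map_add' x y := by
    ext c
    by_cases h : c.1 ∈ I <;> simp [h]
  map_smul' a x := by
    ext c
    by_cases h : c.1 ∈ I <;> simp [h]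

theorem extendZero_injective (I : Finset (Fin M)) : Function.Injective (extendZero F L I) := by
  intro x y h
  ext ⟨k, l⟩
  simpa [extendZero] using congrFun h ((k : Fin M), l)

theorem range_extendZero (I : Finset (Fin M)) :
    LinearMap.range (extendZero F L I) = supportedOn F L I := by
  ext v
  constructor
  · rintro ⟨x, rfl⟩ c hc
    simp [extendZero, hc]
  · intro hv
    refine ⟨fun c => v (c.1, c.2), ?_⟩
    ext c
    by_cases h : c.1 ∈ I
    · simp [extendZero, h]
    · simp [extendZero, h, hv c h]

theorem finrank_supportedOn (I : Finset (Fin M)) :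
    Module.finrank F (supportedOn F L I) = I.card * L := by
  rw [← range_extendZero, LinearMap.finrank_range_of_inj (extendZero_injective I),
    Module.finrank_fintype_fun_eq_card]
  simp

theorem mulVecLin_messageColumns {ρ : Type*} (A : Matrix ρ (Fin M × Fin L) F)
    (I : Finset (Fin M)) :
    (messageColumns A I).mulVecLin = A.mulVecLin ∘ₗ extendZero F L I := by
  refine LinearMap.ext fun x => funext fun r => ?_
  simp only [Matrix.mulVecLin_apply, LinearMap.comp_apply, Matrix.mulVec, dotProduct,
    messageColumns, Matrix.submatrix_apply, id, Fintype.sum_prod_type]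
  rw [← Finset.sum_subset (Finset.subset_univ I), ← Finset.sum_coe_sort I]
  · simp [extendZero]
  · intro k _ hk
    simp [extendZero, hk]

/-- Selecting columns is precomposition with extension by zero, so the column space is the image of
`supportedOn F L I` under `A`. -/
theorem rank_messageColumns {ρ : Type*} [Fintype ρ] (A : Matrix ρ (Fin M × Fin L) F)
    (I : Finset (Fin M)) :
    (messageColumns A I).rank = relCodim (supportedOn F L I) (LinearMap.ker A.mulVecLin) := by
  rw [Matrix.rank, mulVecLin_messageColumns, LinearMap.range_comp, range_extendZero,
    finrank_map_eq_relCodim]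

variable {S : ℕ} {d : Fin S → ℕ}

/-- The kernel of the query sent to server `j`. -/
def serverKer (q : QueryMatrix F M L d) (j : Fin S) : Submodule F (Fin M × Fin L → F) :=
  LinearMap.ker (q.block j).mulVecLin

theorem mulVec_apply_mk (q : QueryMatrix F M L d) (v : Fin M × Fin L → F) (j : Fin S)
    (r : Fin (d j)) : q.mulVec v ⟨j, r⟩ = (q.block j).mulVec v r := rfl

theorem ker_eq_inf_serverKer (q : QueryMatrix F M L d) :
    LinearMap.ker q.mulVecLin = Finset.univ.inf (serverKer q) := by
  ext v
  simp only [Submodule.mem_finsetInf, Finset.mem_univ, true_imp_iff, serverKer,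
    LinearMap.mem_ker, Matrix.mulVecLin_apply]
  constructor
  · intro h j
    ext r
    rw [← mulVec_apply_mk, h]
    rfl
  · intro h
    ext ⟨j, r⟩
    rw [mulVec_apply_mk, h j]
    rfl

theorem rank_messageColumns_block (q : QueryMatrix F M L d) (j : Fin S) (I : Finset (Fin M)) :
    (messageColumns (q.block j) I).rank = relCodim (supportedOn F L I) (serverKer q j) :=
  rank_messageColumns _ _

theorem rank_messageColumns_stacked (q : QueryMatrix F M L d) (I : Finset (Fin M)) :
    (messageColumns q I).rank
      = relCodim (supportedOn F L I) (Finset.univ.inf (serverKer q)) := by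
  rw [rank_messageColumns, ker_eq_inf_serverKer]

/-- If the stacked queries determine message `m`, its columns contribute `L` to every rank. -/
theorem rank_messageColumns_erase {q : QueryMatrix F M L d} {m : Fin M}
    (hq : LinearMap.ker q.mulVecLin ≤ supportedOn F L {m}ᶜ) {I : Finset (Fin M)} (hm : m ∈ I) :
    (messageColumns q I).rank = L + (messageColumns q (I.erase m)).rank := by
  rw [rank_messageColumns, rank_messageColumns]
  -- A kernel vector vanishes on message `m`, so dropping `m` from `I` leaves the trace of the
  -- kernel unchanged while the ambient space loses dimension `L`.
  have e : supportedOn F L I ⊓ LinearMap.ker q.mulVecLin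
      = supportedOn F L (I.erase m) ⊓ LinearMap.ker q.mulVecLin := by
    refine le_antisymm (fun v hv => ⟨fun c hc => ?_, hv.2⟩)
      (inf_le_inf_right _ (supportedOn_mono (Finset.erase_subset _ _)))
    by_cases h : c.1 = m
    · exact hq hv.2 c (by simp [h])
    · exact hv.1 c fun hI => hc (Finset.mem_erase.2 ⟨h, hI⟩)
  have h1 := relCodim_add_finrank (supportedOn F L I) (LinearMap.ker q.mulVecLin)
  have h2 := relCodim_add_finrank (supportedOn F L (I.erase m)) (LinearMap.ker q.mulVecLin)
  rw [finrank_supportedOn] at h1 h2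
  rw [e] at h1
  have h3 : I.card * L = (I.erase m).card * L + L := by
    rw [← Finset.card_erase_add_one hm, Nat.succ_mul]
  omega

theorem rank_stacked_le_sum (q : QueryMatrix F M L d) (I : Finset (Fin M)) :
    (messageColumns q I).rank ≤ ∑ j, (messageColumns (q.block j) I).rank := by
  simp_rw [rank_messageColumns_stacked, rank_messageColumns_block]
  exact relCodim_finset_inf_le_sum _ _ _

theorem rank_block_le_stacked (q : QueryMatrix F M L d) (j : Fin S) (I : Finset (Fin M)) :
    (messageColumns (q.block j) I).rank ≤ (messageColumns q I).rank := by
  rw [rank_messageColumns_stacked, rank_messageColumns_block]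
  exact relCodim_anti _ (Finset.inf_le (Finset.mem_univ j))

/-- Equality of the row spaces of the blocks is inherited by fewer columns. -/
theorem rank_stacked_eq_block_of_subset {q : QueryMatrix F M L d} {I J : Finset (Fin M)}
    (hIJ : I ⊆ J) {j : Fin S}
    (h : (messageColumns q J).rank = (messageColumns (q.block j) J).rank) :
    (messageColumns q I).rank = (messageColumns (q.block j) I).rank := by
  rw [rank_messageColumns_stacked, rank_messageColumns_block] at h ⊢
  -- The two kernels have the same trace on the vectors supported on `J`, hence also on the smaller
  -- space of those supported on `I`.
  have e := inf_eq_of_relCodim_eq (Finset.inf_le (Finset.mem_univ j)) h.symm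
  have hU := supportedOn_mono (F := F) (L := L) hIJ
  rw [relCodim, relCodim, ← inf_eq_left.2 hU, inf_assoc, e, ← inf_assoc]

/-- Each block has at most the rank of the stacked matrix, and an average reaches a common upper
bound only if every term does. -/
theorem sum_rank_block_div_le (hS : 0 < S) (q : QueryMatrix F M L d) (I : Finset (Fin M)) :
    (∑ j, ((messageColumns (q.block j) I).rank : ℝ)) / S ≤ (messageColumns q I).rank ∧
    ((∑ j, ((messageColumns (q.block j) I).rank : ℝ)) / S = (messageColumns q I).rank ↔
      ∀ j, (messageColumns q I).rank = (messageColumns (q.block j) I).rank) := by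
  have hS' : (0 : ℝ) < S := by exact_mod_cast hS
  have hle : ∀ j ∈ Finset.univ, ((messageColumns (q.block j) I).rank : ℝ)
      ≤ (messageColumns q I).rank := fun j _ => by exact_mod_cast rank_block_le_stacked q j I
  have hc : ∑ _j : Fin S, ((messageColumns q I).rank : ℝ) = (messageColumns q I).rank * S := by
    rw [Finset.sum_const, Finset.card_univ, Fintype.card_fin, nsmul_eq_mul, mul_comm]
  constructor
  · rw [div_le_iff₀ hS', ← hc]
    exact Finset.sum_le_sum hle
  · rw [div_eq_iff hS'.ne', ← hc, Finset.sum_eq_sum_iff_of_le hle]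
    simp only [Finset.mem_univ, true_imp_iff, Nat.cast_inj, eq_comm]

end Columns

/-! ### Entropies of a linear scheme as expected ranks -/

section Message

variable {F : Type*} [Field F] {S M L : ℕ} {d : Fin S → ℕ}

/-- The messages in `I` as a function of all message symbols. -/
def messageProj (F : Type*) [Field F] {M : ℕ} (L : ℕ) (I : Finset (Fin M)) :
    (Fin M × Fin L → F) →ₗ[F] (I → Fin L → F) :=
  LinearMap.pi fun k => LinearMap.funLeft F F fun l => ((k : Fin M), l)

theorem ker_messageProj (I : Finset (Fin M)) :
    LinearMap.ker (messageProj F L I) = supportedOn F L Iᶜ := by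
  ext v
  rw [LinearMap.mem_ker, mem_supportedOn]
  constructor
  · rintro h ⟨k, l⟩ hk
    rw [Finset.mem_compl, not_not] at hk
    exact congrFun (congrFun h ⟨k, hk⟩) l
  · intro h
    ext k l
    exact h (k, l) (by simp)

theorem ker_funLeft_message (m : Fin M) :
    LinearMap.ker (LinearMap.funLeft F F fun l : Fin L => (m, l)) = supportedOn F L {m}ᶜ := by
  ext v
  rw [LinearMap.mem_ker, mem_supportedOn]
  constructor
  · rintro h ⟨k, l⟩ hk
    obtain rfl : k = m := by simpa using hk
    exact congrFun h l
  · intro h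
    ext l
    exact h (m, l) (by simp)

/-- The answers of the servers in `T` as a function of all message symbols. -/
def answersMap (q : QueryMatrix F M L d) (T : Finset (Fin S)) :
    (Fin M × Fin L → F) →ₗ[F] ((j : T) → Fin (d j) → F) :=
  LinearMap.pi fun j => (q.block j).mulVecLin

theorem ker_answersMap (q : QueryMatrix F M L d) (T : Finset (Fin S)) :
    LinearMap.ker (answersMap q T) = T.inf (serverKer q) := by
  ext v
  rw [LinearMap.mem_ker, Submodule.mem_finsetInf]
  constructor
  · intro h j hj
    exact congrFun h ⟨j, hj⟩
  · intro h
    ext1 j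
    exact h j j.2

end Message

namespace LinearScheme

variable {F : Type*} [Field F] [Fintype F] [MeasurableSpace F] {S M L : ℕ} {d : Fin S → ℕ}
  {Ω : Type*} [MeasurableSpace Ω] {μ : Measure Ω}

/-- All message symbols as one random vector. -/
def msgVec (P : LinearScheme F M L d μ) (ω : Ω) : Fin M × Fin L → F :=
  fun c => P.msg c.1 ω c.2

/-- The expectation of a function of the stacked queries for the wanted index `m`. -/
noncomputable def expect (P : LinearScheme F M L d μ) (m : Fin M)
    (f : QueryMatrix F M L d → ℝ) : ℝ :=
  ∑ q, μ.real (P.query m ⁻¹' {q}) * f q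

/-- The passage from entropies, which are averages, to statements about every realization: a
pointwise inequality that is tight on average is tight wherever the weight is positive. -/
theorem expect_eq_iff (P : LinearScheme F M L d μ) (m : Fin M) {f g : QueryMatrix F M L d → ℝ}
    (h : ∀ q, P.IsRealization m q → f q ≤ g q) :
    P.expect m f = P.expect m g ↔ ∀ q, P.IsRealization m q → f q = g q := by
  rw [expect, expect, Finset.sum_eq_sum_iff_of_le]
  · refine forall_congr' fun q => ?_
    simp only [Finset.mem_univ, true_imp_iff]
    constructor
    · exact fun he hq => mul_left_cancel₀ (ne_of_gt hq) he
    · intro he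
      rcases measureReal_nonneg.eq_or_lt with h0 | h0
      · rw [← h0, zero_mul, zero_mul]
      · rw [he h0]
  · intro q _
    rcases measureReal_nonneg.eq_or_lt with h0 | h0
    · rw [← h0, zero_mul, zero_mul]
    · exact mul_le_mul_of_nonneg_left (h q h0) h0.le

theorem expect_mono (P : LinearScheme F M L d μ) (m : Fin M) {f g : QueryMatrix F M L d → ℝ}
    (h : ∀ q, P.IsRealization m q → f q ≤ g q) : P.expect m f ≤ P.expect m g := by
  refine Finset.sum_le_sum fun q _ => ?_
  rcases measureReal_nonneg.eq_or_lt with h0 | h0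
  · rw [← h0, zero_mul, zero_mul]
  · exact mul_le_mul_of_nonneg_left (h q h0) h0.le

theorem expect_sum (P : LinearScheme F M L d μ) (m : Fin M) {ι : Type*} (s : Finset ι)
    (f : ι → QueryMatrix F M L d → ℝ) :
    P.expect m (fun q => ∑ i ∈ s, f i q) = ∑ i ∈ s, P.expect m (f i) := by
  simp only [expect, Finset.mul_sum]
  exact Finset.sum_comm

theorem condH_comp_injective (P : LinearScheme F M L d μ) {α β γ : Type*} [Fintype α] [Fintype β]
    [Fintype γ] (X : Ω → α) (Y : Ω → β) {e : β → γ} (he : Function.Injective e) :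
    P.condH X (fun ω => e (Y ω)) = P.condH X Y :=
  condEntropy_comp_injective _ X Y he

/-- The expected sum of the ranks of the blocks, restricted to the messages in `I`. -/
noncomputable def blockRankSum (P : LinearScheme F M L d μ) (m : Fin M)
    (I : Finset (Fin M)) : ℝ :=
  P.expect m fun q => ∑ j, ((messageColumns (q.block j) I).rank : ℝ)

theorem blockRankSum_empty (P : LinearScheme F M L d μ) (m : Fin M) :
    P.blockRankSum m ∅ = 0 := by
  have h : ∀ {ρ : Type} [Fintype ρ] (A : Matrix ρ (Fin M × Fin L) F),
      (messageColumns A ∅).rank = 0 := fun A => by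
    refine Nat.le_zero.1 ((Matrix.rank_le_card_width _).trans ?_)
    simp
  simp [blockRankSum, expect, h]

theorem msgVec_preimage (P : LinearScheme F M L d μ) (v : Fin M × Fin L → F) :
    P.msgVec ⁻¹' {v} = (fun ω k => P.msg k ω) ⁻¹' {fun k l => v (k, l)} := by
  ext ω
  simp only [Set.mem_preimage, Set.mem_singleton_iff, funext_iff, msgVec, Prod.forall]

variable [MeasurableSingletonClass F]

theorem measurableSet_query_preimage (P : LinearScheme F M L d μ) (m : Fin M)
    (E : Set (QueryMatrix F M L d)) : MeasurableSet (P.query m ⁻¹' E) := by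
  have : MeasurableSingletonClass (QueryMatrix F M L d) :=
    inferInstanceAs (MeasurableSingletonClass (QueryRow d → Fin M × Fin L → F))
  exact P.measurable_query m (Set.toFinite E).measurableSet

theorem measurableSet_msgVec_preimage (P : LinearScheme F M L d μ) (v : Fin M × Fin L → F) :
    MeasurableSet (P.msgVec ⁻¹' {v}) := by
  rw [msgVec_preimage]
  exact measurable_pi_lambda _ P.measurable_msg (measurableSet_singleton _)

theorem measureReal_msgVec (P : LinearScheme F M L d μ) (v : Fin M × Fin L → F) :
    μ.real (P.msgVec ⁻¹' {v}) = 1 / Fintype.card (Fin M × Fin L → F) := by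
  have h : P.msgVec ⁻¹' {v} = ⋂ k ∈ Finset.univ, P.msg k ⁻¹' {fun l => v (k, l)} := by
    rw [msgVec_preimage]
    ext ω
    simp [funext_iff]
  rw [h, measureReal_def, P.indep_msg.measure_inter_preimage_eq_mul _
    fun k _ => measurableSet_singleton _, ENNReal.toReal_prod]
  simp_rw [← measureReal_def, P.uniform_msg]
  rw [Finset.prod_const, Finset.card_univ, Fintype.card_fin, Fintype.card_fun, Fintype.card_prod,
    Fintype.card_fin, Fintype.card_fin, div_pow, one_pow, ← pow_mul, Nat.cast_pow, mul_comm L M]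

/-- General events `E` also cover the query to a single server, which is a function of the stacked
query. -/
theorem measureReal_query_inter_msgVec (P : LinearScheme F M L d μ) (m : Fin M)
    (E : Set (QueryMatrix F M L d)) (v : Fin M × Fin L → F) :
    μ.real (P.query m ⁻¹' E ∩ P.msgVec ⁻¹' {v})
      = μ.real (P.query m ⁻¹' E) / Fintype.card (Fin M × Fin L → F) := by
  have : MeasurableSingletonClass (QueryMatrix F M L d) :=
    inferInstanceAs (MeasurableSingletonClass (QueryRow d → Fin M × Fin L → F))
  rw [div_eq_mul_one_div, ← P.measureReal_msgVec v, msgVec_preimage, measureReal_def,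
    Set.inter_comm, (P.indep_query m).measure_inter_preimage_eq_mul _ _
      (measurableSet_singleton _) (Set.toFinite E).measurableSet, ENNReal.toReal_mul, mul_comm]
  rfl

variable [IsProbabilityMeasure μ]

/-- `H(A_Q W | Q, B_Q W)` for a scheme, in terms of the kernels of the linear maps. -/
theorem condH_linear (P : LinearScheme F M L d μ) (m : Fin M) {V₁ V₂ : Type*}
    [AddCommGroup V₁] [Module F V₁] [Fintype V₁] [AddCommGroup V₂] [Module F V₂] [Fintype V₂]
    (A : QueryMatrix F M L d → (Fin M × Fin L → F) →ₗ[F] V₁)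
    (B : QueryMatrix F M L d → (Fin M × Fin L → F) →ₗ[F] V₂)
    {U : Submodule F (Fin M × Fin L → F)}
    {K K' : QueryMatrix F M L d → Submodule F (Fin M × Fin L → F)}
    (hA : ∀ q, LinearMap.ker (A q) = K' q) (hB : ∀ q, LinearMap.ker (B q) = U ⊓ K q) :
    P.condH (fun ω => A (P.query m ω) (P.msgVec ω))
        (fun ω => (P.query m ω, B (P.query m ω) (P.msgVec ω)))
      = P.expect m fun q => (relCodim U (K' q ⊓ K q) : ℝ) - relCodim U (K q) := by
  rw [condH, condEntropy_linear P.measurableSet_msgVec_preimage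
    (fun q => P.measurableSet_query_preimage m {q})
    (fun q v => P.measureReal_query_inter_msgVec m {q} v)]
  refine Finset.sum_congr rfl fun q _ => congrArg _ ?_
  rw [hA, hB, inf_left_comm]
  -- Both codimensions are relative to the same `U`, so its dimension cancels in the difference.
  have h1 := relCodim_add_finrank U (K q)
  have h2 := relCodim_add_finrank U (K' q ⊓ K q)
  rw [sub_eq_sub_iff_add_eq_add]
  norm_cast
  omega

theorem condH_answer_serverQuery (P : LinearScheme F M L d μ) (m : Fin M) (j : Fin S) :
    P.condH (P.answer m j) (P.serverQuery m j)
      = P.expect m fun q => ((messageColumns (q.block j) Finset.univ).rank : ℝ) := by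
  -- A constant `Fin 0 → F` component, the value of `B = 0`, brings conditioning on the query alone
  -- into the form of `condEntropy_linear`.
  have he : Function.Injective
      (fun a : Matrix (Fin (d j)) (Fin M × Fin L) F => (a, (0 : Fin 0 → F))) :=
    fun a b h => congrArg Prod.fst h
  have h := condEntropy_linear (μ := μ) (W := P.msgVec) (Q := P.serverQuery m j)
    P.measurableSet_msgVec_preimage
    (fun a => P.measurableSet_query_preimage m ((fun q => q.block j) ⁻¹' {a}))
    (fun a v => P.measureReal_query_inter_msgVec m ((fun q => q.block j) ⁻¹' {a}) v)
    (fun a => a.mulVecLin) (fun _ => (0 : (Fin M × Fin L → F) →ₗ[F] (Fin 0 → F)))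
  rw [← P.condH_comp_injective _ _ he]
  refine h.trans ?_
  rw [expect, sum_measureReal_mul_comp (fun q => P.measurableSet_query_preimage m {q})
    (fun q => q.block j) fun a => ((messageColumns a Finset.univ).rank : ℝ)]
  refine Finset.sum_congr rfl fun a _ => congrArg _ ?_
  rw [rank_messageColumns, supportedOn_univ, LinearMap.ker_zero, inf_comm]
  have := relCodim_add_finrank ⊤ (LinearMap.ker a.mulVecLin)
  rw [sub_eq_iff_eq_add]
  norm_cast
  exact this.symm

/-- Correctness: the stacked queries determine the wanted message. -/
theorem ker_query_le (P : LinearScheme F M L d μ) (hP : P.IsCorrect) {m : Fin M}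
    {q : QueryMatrix F M L d} (hq : P.IsRealization m q) :
    LinearMap.ker q.mulVecLin ≤ supportedOn F L {m}ᶜ := by
  have h := hP m
  rw [show (fun ω => (P.answers m Finset.univ ω, P.query m ω)) =
      fun ω => Prod.swap (P.query m ω, answersMap (P.query m ω) Finset.univ (P.msgVec ω)) from rfl,
    P.condH_comp_injective _ _ Prod.swap_injective] at h
  have h' := P.condH_linear m (fun _ => LinearMap.funLeft F F fun l : Fin L => (m, l))
    (fun q => answersMap q Finset.univ) (U := ⊤) (fun _ => ker_funLeft_message m)
    (K := fun q => Finset.univ.inf (serverKer q)) fun q => by rw [ker_answersMap, top_inf_eq]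
  have h0 : P.expect m (fun _ => 0) = 0 := by simp [expect]
  -- The integrand is nonnegative with zero mean, so at each realization intersecting with the
  -- kernel of `W_m` does not shrink the kernel of the queries.
  have h2 := (P.expect_eq_iff m (f := fun _ => 0) fun q _ => sub_nonneg.2
    (Nat.cast_le.2 (relCodim_anti _ inf_le_right))).1 (h0.trans (h.symm.trans h')) q hq
  have h3 := inf_eq_of_relCodim_eq inf_le_right (Nat.cast_injective (sub_eq_zero.1 h2.symm)).symm
  rw [top_inf_eq, top_inf_eq] at h3
  rw [ker_eq_inf_serverKer, ← h3]
  exact inf_le_left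

/-- The matrix form of the first condition. -/
theorem condH_answer_eq_zero_iff (P : LinearScheme F M L d μ) (m : Fin M) :
    (∀ i j : Fin S,
      P.condH (P.answer m j) (fun ω => (P.answer m i ω, P.msg m ω, P.query m ω)) = 0) ↔
    ∀ q, P.IsRealization m q → ∀ j : Fin S,
      (messageColumns q {m}ᶜ).rank = (messageColumns (q.block j) {m}ᶜ).rank := by
  have key : ∀ i j : Fin S,
      P.condH (P.answer m j) (fun ω => (P.answer m i ω, P.msg m ω, P.query m ω)) = 0 ↔
      ∀ q, P.IsRealization m q →
        relCodim (supportedOn F L {m}ᶜ) (serverKer q j ⊓ serverKer q i)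
          = relCodim (supportedOn F L {m}ᶜ) (serverKer q i) := by
    intro i j
    have he : Function.Injective fun x : QueryMatrix F M L d × (Fin (d i) → F) × (Fin L → F) =>
        (x.2.1, x.2.2, x.1) := by
      rintro ⟨a, b, c⟩ ⟨a', b', c'⟩ h
      simp_all
    -- Conditioning on `W_m` confines the vectors to `U`, those vanishing on message `m`.
    have h' := P.condH_linear m (fun q => (q.block j).mulVecLin)
      (fun q => (q.block i).mulVecLin.prod (LinearMap.funLeft F F fun l : Fin L => (m, l)))
      (U := supportedOn F L {m}ᶜ) (K := fun q => serverKer q i) (K' := fun q => serverKer q j)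
      (fun _ => rfl) fun q => by
        rw [LinearMap.ker_prod, ker_funLeft_message, inf_comm]
        rfl
    rw [← P.condH_comp_injective _ _ he] at h'
    have h0 : P.expect m (fun _ => 0) = 0 := by simp [expect]
    have h2 := P.expect_eq_iff m (f := fun _ => 0) fun q _ => sub_nonneg.2
      (Nat.cast_le (α := ℝ).2 (relCodim_anti (supportedOn F L {m}ᶜ)
        (inf_le_right : serverKer q j ⊓ serverKer q i ≤ serverKer q i)))
    rw [h0, ← h', eq_comm] at h2
    refine h2.trans (forall₂_congr fun q _ => ?_)
    rw [eq_comm, sub_eq_zero, Nat.cast_inj]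
  simp_rw [key, rank_messageColumns_stacked, rank_messageColumns_block, ← relCodim_pair_eq_iff]
  exact ⟨fun h q hq i j => h i j q hq, fun h i j q hq => h q hq i j⟩

/-- The matrix form of the second condition. -/
theorem condH_answer_msgs_eq_iff (P : LinearScheme F M L d μ) (m : Fin M)
    (I' : Finset (Fin M)) :
    (∀ (j : Fin S) (T : Finset (Fin S)), j ∉ T →
      P.condH (P.answer m j) (fun ω => (P.query m ω, P.msgs I' ω, P.answers m T ω)) =
        P.condH (P.answer m j) (fun ω => (P.query m ω, P.msgs I' ω))) ↔
    ∀ q, P.IsRealization m q →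
      (messageColumns q I'ᶜ).rank = ∑ j, (messageColumns (q.block j) I'ᶜ).rank := by
  have key : ∀ (j : Fin S) (T : Finset (Fin S)),
      P.condH (P.answer m j) (fun ω => (P.query m ω, P.msgs I' ω, P.answers m T ω)) =
        P.condH (P.answer m j) (fun ω => (P.query m ω, P.msgs I' ω)) ↔
      ∀ q, P.IsRealization m q →
        relCodim (supportedOn F L I'ᶜ) (serverKer q j ⊓ T.inf (serverKer q))
          = relCodim (supportedOn F L I'ᶜ) (serverKer q j)
            + relCodim (supportedOn F L I'ᶜ) (T.inf (serverKer q)) := by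
    intro j T
    have h1 := P.condH_linear m (fun q => (q.block j).mulVecLin)
      (fun q => (messageProj F L I').prod (answersMap q T))
      (U := supportedOn F L I'ᶜ) (K := fun q => T.inf (serverKer q))
      (K' := fun q => serverKer q j)
      (fun _ => rfl) fun q => by rw [LinearMap.ker_prod, ker_messageProj, ker_answersMap]
    have h2 := P.condH_linear m (fun q => (q.block j).mulVecLin) (fun _ => messageProj F L I')
      (U := supportedOn F L I'ᶜ) (K := fun _ => ⊤) (K' := fun q => serverKer q j)
      (fun _ => rfl) fun q => by rw [ker_messageProj, inf_top_eq]
    -- Subadditivity of `relCodim` is the pointwise form of "conditioning reduces entropy", so equal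
    -- entropies mean additivity at each realization.
    have h3 := P.expect_eq_iff m
      (f := fun q => (relCodim (supportedOn F L I'ᶜ) (serverKer q j ⊓ T.inf (serverKer q)) : ℝ)
        - relCodim (supportedOn F L I'ᶜ) (T.inf (serverKer q)))
      (g := fun q => (relCodim (supportedOn F L I'ᶜ) (serverKer q j ⊓ ⊤) : ℝ)
        - relCodim (supportedOn F L I'ᶜ) ⊤) fun q _ => by
        have := relCodim_inf_le (supportedOn F L I'ᶜ) (serverKer q j) (T.inf (serverKer q))
        rw [inf_top_eq, relCodim_top, Nat.cast_zero, sub_zero, sub_le_iff_le_add]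
        exact_mod_cast this
    rw [← h1, ← h2] at h3
    refine h3.trans (forall₂_congr fun q _ => ?_)
    rw [inf_top_eq, relCodim_top, Nat.cast_zero, sub_zero, sub_eq_iff_eq_add]
    norm_cast
  simp_rw [rank_messageColumns_stacked, rank_messageColumns_block, ← relCodim_insert_eq_iff]
  exact ⟨fun h q hq j T hj => (key j T).1 (h j T hj) q hq,
    fun h j T hj => (key j T).2 fun q hq => h q hq j T hj⟩

/-- Each summand depends only on the law of one server's query. The rank of the stacked matrix has
no such invariance, since the joint law may vary with the wanted index. -/
theorem blockRankSum_eq_of_isPrivate (P : LinearScheme F M L d μ) (hP : P.IsPrivate)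
    (m m' : Fin M) (I : Finset (Fin M)) : P.blockRankSum m I = P.blockRankSum m' I := by
  rw [blockRankSum, blockRankSum, expect_sum, expect_sum]
  refine Finset.sum_congr rfl fun j _ => ?_
  have h : ∀ m, P.expect m (fun q => ((messageColumns (q.block j) I).rank : ℝ))
      = ∑ a, μ.real (P.serverQuery m j ⁻¹' {a}) * ((messageColumns a I).rank : ℝ) := fun m =>
    sum_measureReal_mul_comp (fun q => P.measurableSet_query_preimage m {q})
      (fun q => q.block j) fun a => ((messageColumns a I).rank : ℝ)
  rw [h, h]
  exact Finset.sum_congr rfl fun a _ => by rw [hP m m' j a]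

theorem expect_add_sum_div (P : LinearScheme F M L d μ) (m : Fin M) (I : Finset (Fin M)) :
    P.expect m (fun q => L + (∑ j, ((messageColumns (q.block j) I).rank : ℝ)) / S)
      = L + P.blockRankSum m I / S := by
  have h1 : ∑ q, μ.real (P.query m ⁻¹' {q}) = 1 := by
    have := sum_measureReal_inter_preimage (μ := μ)
      (fun q => P.measurableSet_query_preimage m {q}) MeasurableSet.univ
    simpa using this
  simp only [expect, blockRankSum, mul_add, Finset.sum_add_distrib, ← Finset.sum_mul, h1, one_mul,
    Finset.sum_div, mul_div_assoc]

/-- Subadditivity over the servers, correctness, and the average bound, chained at each realization;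
the chain is tight iff its first and last links are. -/
theorem le_blockRankSum (P : LinearScheme F M L d μ) (hP : P.IsCorrect) (hS : 0 < S) {m : Fin M}
    {I : Finset (Fin M)} (hm : m ∈ I) :
    L + P.blockRankSum m (I.erase m) / S ≤ P.blockRankSum m I ∧
    (L + P.blockRankSum m (I.erase m) / S = P.blockRankSum m I ↔
      ∀ q, P.IsRealization m q →
        (messageColumns q I).rank = ∑ j, (messageColumns (q.block j) I).rank ∧
        ∀ j, (messageColumns q (I.erase m)).rank
          = (messageColumns (q.block j) (I.erase m)).rank) := by
  rw [← expect_add_sum_div]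
  have h1 : ∀ q : QueryMatrix F M L d, ((messageColumns q I).rank : ℝ)
      ≤ ∑ j, ((messageColumns (q.block j) I).rank : ℝ) := fun q => by
    exact_mod_cast rank_stacked_le_sum q I
  have h2 : ∀ q, P.IsRealization m q → ((messageColumns q I).rank : ℝ)
      = L + (messageColumns q (I.erase m)).rank := fun q hq => by
    exact_mod_cast rank_messageColumns_erase (P.ker_query_le hP hq) hm
  have h3 := fun q : QueryMatrix F M L d => sum_rank_block_div_le hS q (I.erase m)
  have hle : ∀ q, P.IsRealization m q →
      L + (∑ j, ((messageColumns (q.block j) (I.erase m)).rank : ℝ)) / S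
        ≤ ∑ j, ((messageColumns (q.block j) I).rank : ℝ) := fun q hq => by
    linarith [h1 q, h2 q hq, (h3 q).1]
  refine ⟨P.expect_mono m hle, (P.expect_eq_iff m hle).trans (forall₂_congr fun q hq => ?_)⟩
  rw [← (h3 q).2, ← Nat.cast_inj (R := ℝ), Nat.cast_sum]
  constructor
  · intro h
    constructor <;> linarith [h1 q, h2 q hq, (h3 q).1]
  · rintro ⟨h, h'⟩
    linarith [h2 q hq]

theorem H_msg (P : LinearScheme F M L d μ) (m : Fin M) : P.H (P.msg m) = L := by
  have hF : (1 : ℝ) < Fintype.card F := by exact_mod_cast Fintype.one_lt_card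
  refine entropy_eq_of_flat hF ?_ fun w => Or.inr ?_
  · have := sum_measureReal_inter_preimage (μ := μ)
      (fun w => P.measurable_msg m (measurableSet_singleton w)) MeasurableSet.univ
    simpa using this
  · rw [P.uniform_msg, Real.rpow_neg (by linarith), Real.rpow_natCast, one_div]

theorem rate_eq (P : LinearScheme F M L d μ) (hP : P.IsPrivate) (m : Fin M) :
    P.rate = L / P.blockRankSum m Finset.univ := by
  have h : ∀ m', P.H (P.msg m') / ∑ j, P.condH (P.answer m' j) (P.serverQuery m' j)
      = L / P.blockRankSum m Finset.univ := by
    intro m'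
    rw [H_msg, P.blockRankSum_eq_of_isPrivate hP m m', blockRankSum, expect_sum]
    simp_rw [condH_answer_serverQuery]
  have : Nonempty (Fin M) := ⟨m⟩
  rw [rate]
  simp_rw [h]
  exact ciInf_const

end LinearScheme

/-! ### The recursive bound -/

section Recursion

variable {ι : Type*} [Fintype ι] [DecidableEq ι] {f : Finset ι → ℝ} {c : ℕ → ℝ} {l s : ℝ}

/-- A function on finsets that satisfies the recursive bound `l + f (I \ {m}) / s ≤ f I` is
minimal at the top iff the bound is always attained. -/
theorem eq_univ_iff_of_recursive_bound (hs : 0 < s) (hf0 : f ∅ = 0) (hc0 : c 0 = 0)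
    (hc : ∀ n, c (n + 1) = l + c n / s)
    (hf : ∀ I, ∀ m ∈ I, l + f (I.erase m) / s ≤ f I) :
    c (Fintype.card ι) ≤ f Finset.univ ∧
    (f Finset.univ = c (Fintype.card ι) ↔ ∀ I, ∀ m ∈ I, l + f (I.erase m) / s = f I) := by
  have lower : ∀ I : Finset ι, c I.card ≤ f I := by
    intro I
    induction I using Finset.induction_on with
    | empty => simp [hf0, hc0]
    | insert m I hm ih =>
      have := hf (insert m I) m (Finset.mem_insert_self m I)
      rw [Finset.erase_insert hm] at this
      rw [Finset.card_insert_of_notMem hm, hc]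
      exact le_trans (by gcongr) this
  refine ⟨lower _, fun h => ?_, fun h => ?_⟩
  · have upper : ∀ n, ∀ I : Finset ι, Iᶜ.card = n → f I ≤ c I.card := by
      intro n
      induction n with
      | zero =>
        intro I hI
        rw [Finset.card_eq_zero, Finset.compl_eq_empty_iff] at hI
        rw [hI, h, Finset.card_univ]
      | succ n ih =>
        intro I hI
        obtain ⟨m, hm⟩ : Iᶜ.Nonempty := Finset.card_pos.1 (by omega)
        have hm' : m ∉ I := Finset.mem_compl.1 hm
        have h1 := ih (insert m I) (by
          rw [Finset.compl_insert, Finset.card_erase_of_mem hm, hI, Nat.add_sub_cancel])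
        have h2 := hf (insert m I) m (Finset.mem_insert_self m I)
        rw [Finset.erase_insert hm'] at h2
        rw [Finset.card_insert_of_notMem hm', hc] at h1
        exact (div_le_div_iff_of_pos_right hs).1 (by linarith)
    have eq : ∀ I, f I = c I.card := fun I => le_antisymm (upper _ I rfl) (lower I)
    intro I m hm
    rw [eq, eq, ← hc, Finset.card_erase_add_one hm]
  · have eq : ∀ I : Finset ι, f I = c I.card := by
      intro I
      induction I using Finset.induction_on with
      | empty => simp [hf0, hc0]
      | insert m I hm ih =>
        rw [← h _ m (Finset.mem_insert_self m I), Finset.erase_insert hm, ih,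
          Finset.card_insert_of_notMem hm, hc]
    rw [eq, Finset.card_univ]

end Recursion

/-! ### The capacity criterion and its entropy form. -/

namespace LinearScheme

/-- The capacity is attained iff the stacked rank is additive over the servers for the messages
in `I` and equals every server's rank for the messages in `I \ {m}`. -/
theorem rate_eq_pirCapacity_iff {F : Type*} [Field F] [Fintype F] [MeasurableSpace F]
    [MeasurableSingletonClass F] {S M L : ℕ} {d : Fin S → ℕ} {Ω : Type*} [MeasurableSpace Ω]
    {μ : Measure Ω} [IsProbabilityMeasure μ] (hS : 2 ≤ S) (hM : 1 ≤ M) (hL : 1 ≤ L)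
    (P : LinearScheme F M L d μ) (hcorrect : P.IsCorrect) (hprivate : P.IsPrivate) :
    P.rate = pirCapacity S M ↔
      ∀ (I : Finset (Fin M)), ∀ m ∈ I, ∀ q, P.IsRealization m q →
        (messageColumns q I).rank = ∑ j, (messageColumns (q.block j) I).rank ∧
        ∀ j, (messageColumns q (I.erase m)).rank
          = (messageColumns (q.block j) (I.erase m)).rank := by
  have hS1 : (1 : ℝ) < S := by exact_mod_cast hS
  have hS0 : (0 : ℝ) < S := by linarith
  have hL0 : (0 : ℝ) < L := by exact_mod_cast hL
  have hS2 : 1 / (S : ℝ) < 1 := by rwa [div_lt_one hS0]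
  have ha : (0 : ℝ) < 1 - 1 / (S : ℝ) := by linarith
  have hb : 0 < 1 - (1 / (S : ℝ)) ^ M :=
    sub_pos.2 (pow_lt_one₀ (by positivity) hS2 (by omega))
  let m₀ : Fin M := ⟨0, hM⟩
  -- Closed form of `L (1 + 1/S + ⋯ + 1/S^(n-1))`, so that `L / c M` is the capacity.
  let c : ℕ → ℝ := fun n => L * (1 - (1 / (S : ℝ)) ^ n) / (1 - 1 / (S : ℝ))
  have hle : ∀ (I : Finset (Fin M)), ∀ m ∈ I, _ := fun I m hm =>
    P.le_blockRankSum hcorrect (by omega : 0 < S) hm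
  -- The bound at `I` uses the wanted index `m ∈ I`, which changes along the recursion; privacy
  -- makes all these bounds concern one function of `I`.
  simp_rw [fun m I => P.blockRankSum_eq_of_isPrivate hprivate m m₀ I] at hle
  have hc : ∀ n, c (n + 1) = L + c n / S := by
    intro n
    have hS3 : (S : ℝ) - 1 ≠ 0 := by linarith
    simp only [c]
    rw [pow_succ]
    generalize (1 / (S : ℝ)) ^ n = x
    field_simp
    ring
  have key := eq_univ_iff_of_recursive_bound (f := P.blockRankSum m₀) (c := c) hS0
    (P.blockRankSum_empty m₀) (by simp [c]) hc fun I m hm => (hle I m hm).1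
  rw [Fintype.card_fin] at key
  have hcM : 0 < c M := by positivity
  have hpos : 0 < P.blockRankSum m₀ Finset.univ := hcM.trans_le key.1
  rw [P.rate_eq hprivate m₀, pirCapacity, div_eq_div_iff hpos.ne' hb.ne',
    ← forall₂_congr fun I m => forall_congr' fun hm => (hle I m hm).2]
  rw [← key.2, eq_div_iff ha.ne', mul_comm, eq_comm, mul_comm (1 - 1 / (S : ℝ))]

end LinearScheme

theorem mainTheorem3 {F : Type*} [Field F] [Fintype F] [MeasurableSpace F]
    [MeasurableSingletonClass F] {S M L : ℕ} (hS : 2 ≤ S) (hM : 2 ≤ M) (hL : 1 ≤ L)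
    (d : Fin S → ℕ) {Ω : Type*} [MeasurableSpace Ω] (μ : Measure Ω) [IsProbabilityMeasure μ]
    (P : LinearScheme F M L d μ) (hcorrect : P.IsCorrect) (hprivate : P.IsPrivate) :
    -- capacity is attained iff the two entropy conditions hold
    (P.rate = pirCapacity S M ↔
      (∀ (m : Fin M) (i j : Fin S),
        P.condH (P.answer m j) (fun ω => (P.answer m i ω, P.msg m ω, P.query m ω)) = 0) ∧
      (∀ (m : Fin M) (I' : Finset (Fin M)), m ∉ I' →
        ∀ (j : Fin S) (T : Finset (Fin S)), j ∉ T →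
          P.condH (P.answer m j) (fun ω => (P.query m ω, P.msgs I' ω, P.answers m T ω)) =
            P.condH (P.answer m j) (fun ω => (P.query m ω, P.msgs I' ω)))) ∧
    -- matrix form of the first condition
    ((∀ (m : Fin M) (i j : Fin S),
        P.condH (P.answer m j) (fun ω => (P.answer m i ω, P.msg m ω, P.query m ω)) = 0) ↔
      (∀ (m : Fin M) (q : QueryMatrix F M L d), P.IsRealization m q → ∀ j : Fin S,
        (messageColumns q {m}ᶜ).rank = (messageColumns (q.block j) {m}ᶜ).rank)) ∧
    -- matrix form of the second condition
    ((∀ (m : Fin M) (I' : Finset (Fin M)), m ∉ I' →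
        ∀ (j : Fin S) (T : Finset (Fin S)), j ∉ T →
          P.condH (P.answer m j) (fun ω => (P.query m ω, P.msgs I' ω, P.answers m T ω)) =
            P.condH (P.answer m j) (fun ω => (P.query m ω, P.msgs I' ω))) ↔
      (∀ (m : Fin M) (q : QueryMatrix F M L d), P.IsRealization m q →
        ∀ I : Finset (Fin M), m ∈ I →
          (messageColumns q I).rank = ∑ j, (messageColumns (q.block j) I).rank)) := by

  have h1 := fun m => P.condH_answer_eq_zero_iff m
  have h2 := fun m I' => P.condH_answer_msgs_eq_iff m I'
  have e1 := forall_congr' h1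
  have e2 : (∀ (m : Fin M) (I' : Finset (Fin M)), m ∉ I' →
        ∀ (j : Fin S) (T : Finset (Fin S)), j ∉ T →
          P.condH (P.answer m j) (fun ω => (P.query m ω, P.msgs I' ω, P.answers m T ω)) =
            P.condH (P.answer m j) (fun ω => (P.query m ω, P.msgs I' ω))) ↔
      (∀ (m : Fin M) (q : QueryMatrix F M L d), P.IsRealization m q →
        ∀ I : Finset (Fin M), m ∈ I →
          (messageColumns q I).rank = ∑ j, (messageColumns (q.block j) I).rank) := by
    constructor
    · intro h m q hq I hm
      have := (h2 m Iᶜ).1 (h m Iᶜ (by simpa using hm)) q hq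
      rwa [compl_compl] at this
    · intro h m I' hm
      exact (h2 m I').2 fun q hq => h m q hq I'ᶜ (by simpa using hm)
  refine ⟨?_, e1, e2⟩
  rw [e1, e2, P.rate_eq_pirCapacity_iff hS (by omega) hL hcorrect hprivate]
  constructor
  · intro h
    refine ⟨fun m q hq j => ?_, fun m q hq I hm => (h I m hm q hq).1⟩
    -- Condition 1 is the case `I = univ`.
    have := (h Finset.univ m (Finset.mem_univ m) q hq).2 j
    rwa [← Finset.compl_singleton] at this
  · rintro ⟨ha, hb⟩ I m hm q hq
    -- Condition 1 on the columns `{m}ᶜ` restricts to the subset `I.erase m`.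
    refine ⟨hb m q hq I hm, fun j => rank_stacked_eq_block_of_subset ?_ (ha m q hq j)⟩
    intro k hk
    simpa using Finset.ne_of_mem_erase hk
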